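/- **Setting (departing bandits).** There are $M$ user types and $K$ categories, a prior $\mathbf q$ over types, click probabilities $\mathbf P_{a,x}\in[0,1)$ and departure probabilities $\mathbf\Lambda_{a,x}\in(0,1]$. Users arrive one after another; each has an independent type drawn from $\mathbf q$. While a user of type $x$ is present, a category $a$ is recommended to her; she clicks with probability $\mathbf P_{a,x}$ (reward $1$), and otherwise (reward $0$) she departs with probability $\mathbf\Lambda_{a,x}$. A policy $\pi$ maps the history of previous recommendations and responses of the current user to a category. Its return $V^\pi$ is the total reward collected from a user until she departs. A random variable $X$ is $(\tau^2,b)$-sub-exponential ($\tau,b>0$) if $\mathbb E[\exp(\gamma(X-\mathbb E X))]\le\exp(\gamma^2\tau^2/2)$ for all $|\gamma|<1/b$. A finite non-empty set $\Pi$ of policies has associated parameters $\tilde\tau,\eta$ if for every $\pi\in\Pi$ the return $V^\pi$ is $(\tau^2,b)$-sub-exponential for some $\tau,b>0$ (which may depend on $\pi$) with $\tau\le\tilde\tau$ and $b^2/\tau^2\le\eta$. **UCB-Hybrid** (inputs $\Pi,T,\tilde\tau,\eta$). For user $t=1,\dots,T$, execute a policy $\pi_t\in\arg\max_{\pi\in\Pi}U_{t-1}(\pi)$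 on user $t$ (ties are broken in any way that depends only on the past and on independent randomization) and observe its return. Here, if $n$ is the number of the first $t$ users on whom $\pi$ was executed and $\bar V$ is the mean of the $n$ returns received from $\pi$, then $U_t(\pi)=\infty$ if $n=0$, $U_t(\pi)=\bar V+\frac{8\sqrt\eta\,\tilde\tau\ln T}{n}$ if $0<n<8\eta\ln T$, and $U_t(\pi)=\bar V+\sqrt{\frac{8\tilde\tau^2\ln T}{n}}$ otherwise. **Theorem.** For all $\tilde\tau,\eta,D$ there is a constant $C=C(\tilde\tau,\eta,D)$ such that for every departing bandits instance (with any $M,K,\mathbf q,\mathbf P,\mathbf\Lambda$), every finite non-empty policy set $\Pi$ with associated parameters $\tilde\tau,\eta$ whose expected returns differ from each other by at most $D$, every $T\ge2$, and every run of UCB-Hybrid, the policies $\pi_1,\dots,\pi_T$ that it selects satisfy $$\mathbb E\Big[\max_{\pi\in\Pi}T\cdot\mathbb E[V^\pi]-\sum_{t=1}^TV^{\pi_t}\Big]\le C\left(\sqrt{|\Pi|\,T\log T}+|\Pi|\log T\right),$$ where $V^{\pi_t}$ is the return received from user $t$ and the random variable on the left is integrable. -/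

import Mathlib

open MeasureTheory ProbabilityTheory
open scoped Classical

/-- An instance of the departing bandits problem with `M` user types and `K` categories: a prior
over types, click probabilities and departure probabilities. Departure with probability one
after a no-click is allowed, and so is a category that is never clicked. -/
structure DepartingBandit (M K : ℕ) where
  prior : Fin M → ℝ
  click : Fin K → Fin M → ℝ
  depart : Fin K → Fin M → ℝ
  prior_nonneg : ∀ x, 0 ≤ prior x
  prior_sum : ∑ x, prior x = 1
  click_nonneg : ∀ a x, 0 ≤ click a x
  click_lt_one : ∀ a x, click a x < 1
  depart_pos : ∀ a x, 0 < depart a x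
  depart_le_one : ∀ a x, depart a x ≤ 1

/-- A user: her type and, for every iteration `j` and category `a`, two coins. The first one says
whether she clicks if `a` is recommended in iteration `j`, and the second one whether she departs
if she does not click. -/
abbrev User (M K : ℕ) : Type := Fin M × (ℕ × Fin K → Bool × Bool)

/-- A policy maps the history of previous interactions with the user (the recommended categories
together with the click or no-click responses, oldest first) to a category. -/
abbrev Policy (K : ℕ) : Type := List (Fin K × Bool) → Fin K

namespace DepartingBandit

variable {M K : ℕ}

/-- The law of the two coins of category `a` in one iteration, for a user of type `x`. -/
noncomputable def coinLaw (env : DepartingBandit M K) (x : Fin M) (a : Fin K) :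
    Measure (Bool × Bool) :=
  (bernoulliMeasure true false
      ⟨env.click a x, env.click_nonneg a x, (env.click_lt_one a x).le⟩).prod
    (bernoulliMeasure true false
      ⟨env.depart a x, (env.depart_pos a x).le, env.depart_le_one a x⟩)

/-- The law of a user: the type is drawn from the prior and, given the type, all coins are
independent. -/
noncomputable def userLaw (env : DepartingBandit M K) : Measure (User M K) :=
  ∑ x : Fin M, ENNReal.ofReal (env.prior x) •
    (Measure.dirac x).prod (Measure.infinitePi fun ja : ℕ × Fin K => env.coinLaw x ja.2)

end DepartingBandit

namespace Policy

variable {M K : ℕ}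

/-- The first `j` interactions of the policy `π` with the user `u` (if she stays that long). -/
def history (π : Policy K) (u : User M K) : ℕ → List (Fin K × Bool)
  | 0 => []
  | j + 1 =>
    history π u j ++ [(π (history π u j), (u.2 (j, π (history π u j))).1)]

/-- The category recommended by `π` to `u` in iteration `j` (iterations are counted from `0`). -/
def category (π : Policy K) (u : User M K) (j : ℕ) : Fin K := π (history π u j)

/-- User `u` clicks in iteration `j` under `π`. -/
def Clicks (π : Policy K) (u : User M K) (j : ℕ) : Prop :=
  (u.2 (j, category π u j)).1 = true

/-- User `u` would leave in iteration `j` under `π`: she does not click, and her departure coin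
for that iteration comes up true. -/
def Departs (π : Policy K) (u : User M K) (j : ℕ) : Prop :=
  ¬ Clicks π u j ∧ (u.2 (j, category π u j)).2 = true

/-- The number of iterations until the user departs; a user who never departs, an event of
probability zero, gets the value `0`. -/
noncomputable def episodeLength (π : Policy K) (u : User M K) : ℕ :=
  sInf {n | ∃ j, n = j + 1 ∧ Departs π u j}

/-- The return of `π` from user `u`: the number of clicks until the user departs. -/
noncomputable def value (π : Policy K) (u : User M K) : ℝ :=
  ∑ j ∈ Finset.range (episodeLength π u), if Clicks π u j then 1 else 0

/-- The expected return of `π`. -/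
noncomputable def expectedValue (π : Policy K) (env : DepartingBandit M K) : ℝ :=
  ∫ u, value π u ∂env.userLaw

end Policy

/-- `X` is sub-exponential with parameters `(τsq, b)` under `μ`. -/
def IsSubExponential {Ω : Type*} [MeasurableSpace Ω] (X : Ω → ℝ) (τsq b : ℝ)
    (μ : Measure Ω) : Prop :=
  Integrable X μ ∧ ∀ γ : ℝ, |γ| < 1 / b →
    Integrable (fun ω => Real.exp (γ * (X ω - ∫ ω', X ω' ∂μ))) μ ∧
      ∫ ω, Real.exp (γ * (X ω - ∫ ω', X ω' ∂μ)) ∂μ ≤ Real.exp (γ ^ 2 * τsq / 2)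

/-- `τt` and `η` are parameters associated with the policy set `S`. -/
def AssociatedParameters {M K : ℕ} (env : DepartingBandit M K) (S : Finset (Policy K))
    (τt η : ℝ) : Prop :=
  ∀ π ∈ S, ∃ τ b : ℝ, 0 < τ ∧ 0 < b ∧
    IsSubExponential (fun u : User M K => π.value u) (τ ^ 2) b env.userLaw ∧
    τ ≤ τt ∧ b ^ 2 / τ ^ 2 ≤ η

section UCBHybrid

variable {M K : ℕ}

/-- The number of users among the users `0, …, t - 1` to whom `π` was applied, if `c s` is the
policy applied to user `s`. -/
noncomputable def pulls (c : ℕ → Policy K) (π : Policy K) (t : ℕ) : ℕ :=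
  ((Finset.range t).filter fun s => c s = π).card

/-- The sum of the returns that were received from `π` on the users `0, …, t - 1`. -/
noncomputable def returnSum (c : ℕ → Policy K) (u : ℕ → User M K) (π : Policy K) (t : ℕ) : ℝ :=
  ∑ s ∈ (Finset.range t).filter fun s => c s = π, π.value (u s)

/-- The upper confidence bound of `π` after `t` users in a run of UCB-Hybrid with horizon `T`: it
is infinite as long as `π` was not used, and afterwards the empirical mean of the returns of `π`
plus the hybrid confidence radius. -/
noncomputable def ucbIndex (τt η : ℝ) (T : ℕ) (c : ℕ → Policy K) (u : ℕ → User M K)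
    (π : Policy K) (t : ℕ) : EReal :=
  if pulls c π t = 0 then ⊤
  else if (pulls c π t : ℝ) < 8 * η * Real.log T then
    ((returnSum c u π t / pulls c π t
      + 8 * Real.sqrt η * τt * Real.log T / pulls c π t : ℝ) : EReal)
  else
    ((returnSum c u π t / pulls c π t
      + Real.sqrt (8 * τt ^ 2 * Real.log T / pulls c π t) : ℝ) : EReal)

/-- A run of UCB-Hybrid with policy set `S`, horizon `T` and parameters `τt`, `η`. The users
`U 0, …, U (T - 1)` are drawn independently from the user law, `ℱ t` is the information before
user `t` arrives, and `c t` is the policy applied to user `t`. It is chosen on the basis of `ℱ t`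
among the maximizers in `S` of the current upper confidence bounds. Ties may be broken in any way;
a randomized tie-breaking is covered because `ℱ t` may contain more than the past users. -/
structure IsUCBHybridRun {Ω : Type*} {mΩ : MeasurableSpace Ω} (μ : Measure Ω)
    (env : DepartingBandit M K) (S : Finset (Policy K)) (τt η : ℝ) (T : ℕ)
    (ℱ : Filtration ℕ mΩ) (U : ℕ → Ω → User M K) (c : ℕ → Ω → Policy K) : Prop where
  user_measurable : ∀ t < T, Measurable[ℱ (t + 1)] (U t)
  user_law : ∀ t < T, HasLaw (U t) env.userLaw μ
  user_indep : ∀ t < T, Indep (MeasurableSpace.comap (U t) inferInstance) (ℱ t) μ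
  choice_measurable : ∀ t < T, ∀ π : Policy K, MeasurableSet[ℱ t] {ω | c t ω = π}
  choice_mem : ∀ t < T, ∀ ω, c t ω ∈ S
  choice_max : ∀ t < T, ∀ ω, ∀ π ∈ S,
    ucbIndex τt η T (fun s => c s ω) (fun s => U s ω) π t
      ≤ ucbIndex τt η T (fun s => c s ω) (fun s => U s ω) (c t ω) t

/-- The regret with respect to the best policy of `S` in expectation: `T` times the largest
expected return of a policy of `S`, minus the sum of the returns received. -/
noncomputable def regret {Ω : Type*} (env : DepartingBandit M K) (S : Finset (Policy K))
    (hS : S.Nonempty) (T : ℕ) (U : ℕ → Ω → User M K) (c : ℕ → Ω → Policy K) (ω : Ω) : ℝ :=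
  S.sup' hS (fun π => T * π.expectedValue env)
    - ∑ t ∈ Finset.range T, (c t ω).value (U t ω)

end UCBHybrid

/-! Optimism, with a concentration bound suited to sub-exponential returns. Suppose every empirical
mean lies within its confidence radius. Then the chosen index is at least the best mean, so after `8
* η * log T` uses a policy loses at most twice its radius, of order `√(log T / n)`; before that it
loses at most `D` per use. Summing over uses (`sum_lossBound_le`) and applying Cauchy–Schwarz over
policies (`sum_lossBound_pulls_le`) gives both terms of the bound.

The sample size of a policy is random and depends on the data. For fixed `γ` with `|γ| < 1 / b`, the
exponential of `γ` times the centred return sum, compensated by `γ ^ 2 * τ ^ 2 / 2` per use, has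
mean at most `1` at every time (`expProcess_supermartingale`). For each possible count `n`, a
deterministic `γ` makes a deviation beyond the radius force this process, for `γ` or `-γ`, above `T
^ 3` (`exists_exponent`). Adding over `n < T`, both signs and all policies, failures have expected
weight at most `2 * S.card / T ^ 2` per round, hence a negligible total cost. -/

/-! ### Measurability of the return of a policy -/

namespace Policy

variable {M K : ℕ}

/-- There are only countably many histories, so conditioning on the previous one turns the random
coin index into a fixed coordinate. -/
lemma measurableSet_history_eq (π : Policy K) (j : ℕ) (h : List (Fin K × Bool)) :
    MeasurableSet {u : User M K | history π u j = h} := by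
  induction j generalizing h with
  | zero => exact MeasurableSet.const ([] = h)
  | succ j ih =>
    have : {u : User M K | history π u (j + 1) = h} =
        ⋃ h' : List (Fin K × Bool), {u : User M K | history π u j = h'} ∩
          {u : User M K | h' ++ [(π h', (u.2 (j, π h')).1)] = h} := by
      ext u
      simp [history]
    rw [this]
    refine MeasurableSet.iUnion fun h' => (ih h').inter ?_
    have hm : Measurable fun u : User M K => (u.2 (j, π h')).1 := by fun_prop
    exact hm (MeasurableSet.of_discrete (s := {b : Bool | h' ++ [(π h', b)] = h}))

lemma measurableSet_coins (π : Policy K) (j : ℕ) (s : Set (Bool × Bool)) :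
    MeasurableSet {u : User M K | u.2 (j, category π u j) ∈ s} := by
  have : {u : User M K | u.2 (j, category π u j) ∈ s} =
      ⋃ h : List (Fin K × Bool), {u : User M K | history π u j = h} ∩
        {u : User M K | u.2 (j, π h) ∈ s} := by
    ext u
    simp [category]
  rw [this]
  refine MeasurableSet.iUnion fun h => (measurableSet_history_eq π j h).inter ?_
  have hm : Measurable fun u : User M K => u.2 (j, π h) := by fun_prop
  exact hm MeasurableSet.of_discrete

lemma measurableSet_clicks (π : Policy K) (j : ℕ) :
    MeasurableSet {u : User M K | Clicks π u j} :=
  measurableSet_coins π j {p | p.1 = true}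

lemma measurableSet_departs (π : Policy K) (j : ℕ) :
    MeasurableSet {u : User M K | Departs π u j} :=
  measurableSet_coins π j {p | ¬ p.1 = true ∧ p.2 = true}

/-- The second alternative comes from `sInf ∅ = 0`: a user who never departs has length `0`. -/
lemma episodeLength_le_iff (π : Policy K) (u : User M K) (n : ℕ) :
    episodeLength π u ≤ n ↔ (∃ j < n, Departs π u j) ∨ ∀ j, ¬ Departs π u j := by
  unfold episodeLength
  constructor
  · intro h
    by_cases hd : ∃ j, Departs π u j
    · obtain ⟨j, hj⟩ := hd
      have hne : {n | ∃ j, n = j + 1 ∧ Departs π u j}.Nonempty := ⟨j + 1, j, rfl, hj⟩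
      obtain ⟨i, hi, hdi⟩ := Nat.sInf_mem hne
      exact Or.inl ⟨i, by omega, hdi⟩
    · exact Or.inr (not_exists.mp hd)
  · rintro (⟨j, hj, hd⟩ | h)
    · have hmem : j + 1 ∈ {n | ∃ j, n = j + 1 ∧ Departs π u j} := ⟨j, rfl, hd⟩
      exact (Nat.sInf_le hmem).trans hj
    · have : {n | ∃ j, n = j + 1 ∧ Departs π u j} = ∅ := by
        ext m
        simp [h]
      rw [this]
      simp

lemma measurable_episodeLength (π : Policy K) :
    Measurable fun u : User M K => episodeLength π u := by
  refine measurable_of_Iic fun n => ?_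
  have : (fun u : User M K => episodeLength π u) ⁻¹' Set.Iic n =
      (⋃ j, ⋃ (_ : j < n), {u | Departs π u j}) ∪ ⋂ j, {u | Departs π u j}ᶜ := by
    ext u
    simp [episodeLength_le_iff]
  rw [this]
  exact (MeasurableSet.iUnion fun j => MeasurableSet.iUnion fun _ =>
    measurableSet_departs π j).union
      (MeasurableSet.iInter fun j => (measurableSet_departs π j).compl)

lemma measurable_value (π : Policy K) : Measurable fun u : User M K => value π u := by
  -- The number of summands is random; freeing it as a second, countable variable leaves a finite
  -- sum for each value.
  have h : Measurable fun p : User M K × ℕ =>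
      ∑ j ∈ Finset.range p.2, if Clicks π p.1 j then (1 : ℝ) else 0 := by
    refine measurable_from_prod_countable_left fun n => ?_
    have hj : ∀ j, Measurable fun u : User M K => if Clicks π u j then (1 : ℝ) else 0 :=
      fun j => Measurable.ite (measurableSet_clicks π j) measurable_const measurable_const
    exact Finset.measurable_fun_sum (Finset.range n) fun j _ => hj j
  exact h.comp (measurable_id.prodMk (measurable_episodeLength π))

end Policy

/-! ### Counting the uses of each policy -/

section Pulls

variable {M K : ℕ}

lemma pulls_succ (c : ℕ → Policy K) (π : Policy K) (t : ℕ) :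
    pulls c π (t + 1) = pulls c π t + if c t = π then 1 else 0 := by
  unfold pulls
  rw [Finset.range_add_one, Finset.filter_insert]
  split_ifs <;> simp

lemma returnSum_succ (c : ℕ → Policy K) (u : ℕ → User M K) (π : Policy K) (t : ℕ) :
    returnSum c u π (t + 1) = returnSum c u π t + if c t = π then π.value (u t) else 0 := by
  unfold returnSum
  rw [Finset.range_add_one, Finset.filter_insert]
  split_ifs <;> simp [add_comm]

lemma pulls_le (c : ℕ → Policy K) (π : Policy K) (t : ℕ) : pulls c π t ≤ t :=
  (Finset.card_filter_le _ _).trans (Finset.card_range t).le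

/-- A sum over the rounds of a quantity that depends only on the number of earlier uses of the
current policy, regrouped by policy. -/
lemma sum_pulls_eq (S : Finset (Policy K)) (c : ℕ → Policy K) (g : ℕ → ℝ) (T : ℕ)
    (hc : ∀ t < T, c t ∈ S) :
    ∑ t ∈ Finset.range T, g (pulls c (c t) t) =
      ∑ π ∈ S, ∑ n ∈ Finset.range (pulls c π T), g n := by
  induction T with
  | zero => simp [pulls]
  | succ T ih =>
    rw [Finset.sum_range_succ, ih fun t ht => hc t (by omega)]
    have : ∀ π ∈ S, ∑ n ∈ Finset.range (pulls c π (T + 1)), g n =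
        ∑ n ∈ Finset.range (pulls c π T), g n + if c T = π then g (pulls c π T) else 0 := by
      intro π _
      rw [pulls_succ]
      split_ifs <;> simp [Finset.sum_range_succ]
    rw [Finset.sum_congr rfl this, Finset.sum_add_distrib, Finset.sum_ite_eq,
      if_pos (hc T (by omega))]

lemma sum_pulls (S : Finset (Policy K)) (c : ℕ → Policy K) (T : ℕ) (hc : ∀ t < T, c t ∈ S) :
    ∑ π ∈ S, (pulls c π T : ℝ) = T := by
  simpa using (sum_pulls_eq S c (fun _ => 1) T hc).symm

end Pulls

/-! ### Sums of confidence radii -/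

lemma sum_range_inv_sqrt_le (N : ℕ) :
    ∑ n ∈ Finset.range N, 1 / Real.sqrt n ≤ 2 * Real.sqrt N := by
  -- The term `n = 0` vanishes because `1 / 0 = 0`, which frees one summand; the others telescope
  -- through `1 / √(N + 1) ≤ 2 * (√(N + 1) - √N)`.
  have key : ∀ N : ℕ, ∑ n ∈ Finset.range (N + 1), 1 / Real.sqrt n ≤ 2 * Real.sqrt N := by
    intro N
    induction N with
    | zero => simp
    | succ N ih =>
      rw [Finset.sum_range_succ]
      have ha : 0 ≤ Real.sqrt N := Real.sqrt_nonneg _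
      have hb : 0 < Real.sqrt ((N + 1 : ℕ) : ℝ) := Real.sqrt_pos.mpr (by positivity)
      have ha2 : Real.sqrt N ^ 2 = N := Real.sq_sqrt (by positivity)
      have hb2 : Real.sqrt ((N + 1 : ℕ) : ℝ) ^ 2 = N + 1 := by
        rw [Real.sq_sqrt (by positivity)]
        push_cast
        ring
      have : 1 / Real.sqrt ((N + 1 : ℕ) : ℝ) ≤
          2 * Real.sqrt ((N + 1 : ℕ) : ℝ) - 2 * Real.sqrt N := by
        rw [div_le_iff₀ hb]
        nlinarith [sq_nonneg (Real.sqrt ((N + 1 : ℕ) : ℝ) - Real.sqrt N)]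
      linarith
  cases N with
  | zero => simp
  | succ N =>
    refine (key N).trans ?_
    gcongr
    exact Nat.le_succ N

lemma card_range_filter_lt_le (N : ℕ) {a : ℝ} (ha : 0 ≤ a) :
    (((Finset.range N).filter fun n : ℕ => (n : ℝ) < a).card : ℝ) ≤ a + 1 := by
  have h : ((Finset.range N).filter fun n : ℕ => (n : ℝ) < a) ⊆ Finset.range ⌈a⌉₊ := by
    intro n hn
    simp only [Finset.mem_filter] at hn
    exact Finset.mem_range.mpr (Nat.lt_ceil.mpr hn.2)
  have h2 : (((Finset.range N).filter fun n : ℕ => (n : ℝ) < a).card : ℝ) ≤ (⌈a⌉₊ : ℝ) := by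
    exact_mod_cast (Finset.card_le_card h).trans (Finset.card_range _).le
  exact h2.trans (Nat.ceil_lt_add_one ha).le

/-- The confidence radius of UCB-Hybrid after `n` uses of a policy. -/
noncomputable def hybridRadius (τt η L : ℝ) (n : ℕ) : ℝ :=
  if (n : ℝ) < 8 * η * L then 8 * Real.sqrt η * τt * L / n else Real.sqrt (8 * τt ^ 2 * L / n)

/-- A bound for the loss caused by a policy that was used `n` times before, as long as the
empirical means are within the confidence radius. -/
noncomputable def lossBound (τt η D L : ℝ) (n : ℕ) : ℝ :=
  if (n : ℝ) < 8 * η * L then D else 2 * Real.sqrt (8 * τt ^ 2 * L / n)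

/-- At most `8 * η * L + 1` counts lie below the threshold and cost `D` each; the remaining terms
are multiples of `1 / √n`. -/
lemma sum_lossBound_le {τt η D L : ℝ} (hτ : 0 ≤ τt) (hη : 0 ≤ η) (hD : 0 ≤ D) (hL : 0 ≤ L)
    (N : ℕ) :
    ∑ n ∈ Finset.range N, lossBound τt η D L n ≤
      D * (8 * η * L + 1) + 4 * Real.sqrt 8 * τt * Real.sqrt L * Real.sqrt N := by
  have h : ∀ n : ℕ, lossBound τt η D L n ≤
      (if (n : ℝ) < 8 * η * L then D else 0) +
        2 * Real.sqrt 8 * τt * Real.sqrt L * (1 / Real.sqrt n) := by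
    intro n
    unfold lossBound
    split_ifs
    · have : 0 ≤ 2 * Real.sqrt 8 * τt * Real.sqrt L * (1 / Real.sqrt n) := by positivity
      linarith
    · rw [Real.sqrt_div (by positivity), Real.sqrt_mul (by positivity),
        Real.sqrt_mul (by positivity), Real.sqrt_sq hτ]
      apply le_of_eq
      ring
  refine (Finset.sum_le_sum fun n _ => h n).trans ?_
  rw [Finset.sum_add_distrib, ← Finset.sum_filter, Finset.sum_const, ← Finset.mul_sum,
    nsmul_eq_mul]
  have h1 := card_range_filter_lt_le N (a := 8 * η * L) (by positivity)
  have h2 := sum_range_inv_sqrt_le N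
  have h3 : 2 * Real.sqrt 8 * τt * Real.sqrt L * ∑ n ∈ Finset.range N, 1 / Real.sqrt n ≤
      2 * Real.sqrt 8 * τt * Real.sqrt L * (2 * Real.sqrt N) := by gcongr
  nlinarith [mul_le_mul_of_nonneg_right h1 hD]

/-- The total loss, as long as all empirical means are within the confidence radius. -/
lemma sum_lossBound_pulls_le {K : ℕ} {τt η D L : ℝ} (hτ : 0 ≤ τt) (hη : 0 ≤ η) (hD : 0 ≤ D)
    (hL : 0 ≤ L) (S : Finset (Policy K)) (c : ℕ → Policy K) (T : ℕ) (hc : ∀ t < T, c t ∈ S) :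
    ∑ t ∈ Finset.range T, lossBound τt η D L (pulls c (c t) t) ≤
      S.card * (D * (8 * η * L + 1)) + 4 * Real.sqrt 8 * τt * Real.sqrt (S.card * T * L) := by
  rw [sum_pulls_eq S c _ T hc]
  refine (Finset.sum_le_sum fun π _ => sum_lossBound_le hτ hη hD hL _).trans ?_
  rw [Finset.sum_add_distrib, Finset.sum_const, nsmul_eq_mul, ← Finset.mul_sum]
  -- Cauchy–Schwarz, since the use counts add up to `T`.
  have hCS : ∑ π ∈ S, Real.sqrt (pulls c π T) ≤ Real.sqrt (S.card * T) := by
    refine Real.le_sqrt_of_sq_le ?_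
    refine (sq_sum_le_card_mul_sum_sq (s := S)).trans (le_of_eq ?_)
    rw [← sum_pulls S c T hc]
    congr 1
    exact Finset.sum_congr rfl fun π _ => Real.sq_sqrt (by positivity)
  have : Real.sqrt (S.card * T * L) = Real.sqrt L * Real.sqrt (S.card * T) := by
    rw [mul_comm, Real.sqrt_mul hL]
  rw [this]
  have h3 : 4 * Real.sqrt 8 * τt * Real.sqrt L * ∑ π ∈ S, Real.sqrt (pulls c π T) ≤
      4 * Real.sqrt 8 * τt * Real.sqrt L * Real.sqrt (S.card * T) := by gcongr
  linarith

/-! ### Choice of the exponent in the Chernoff bound -/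

/-- This explains the hybrid radius. The Gaussian choice of `γ`, proportional to `√(L / n)`, is
admissible only when `n ≥ 8 * η * L`. For smaller `n`, `γ` stays at a fixed admissible value and the
radius must grow like `L / n`. In both regimes the quadratic term is at most `L` and the linear term
at least `4 * L`. -/
lemma exists_exponent {τt η L τ b : ℝ} (hL : 0 < L) (hτ : 0 < τ) (hb : 0 < b) (hτt : τ ≤ τt)
    (hη : b ^ 2 / τ ^ 2 ≤ η) {n : ℕ} (hn : 0 < n) :
    ∃ γ : ℝ, 0 ≤ γ ∧ γ < 1 / b ∧
      γ ^ 2 * τ ^ 2 / 2 * n - γ * (n * hybridRadius τt η L n) ≤ -(3 * L) := by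
  have hη0 : 0 < η := lt_of_lt_of_le (by positivity) hη
  have hs : 0 < Real.sqrt η := Real.sqrt_pos.mpr hη0
  have hs2 : Real.sqrt η ^ 2 = η := Real.sq_sqrt hη0.le
  have hbs : b ≤ Real.sqrt η * τ := by
    refine (sq_le_sq₀ hb.le (by positivity)).mp ?_
    rw [mul_pow, hs2]
    rwa [div_le_iff₀ (by positivity)] at hη
  have hn' : (0 : ℝ) < n := by exact_mod_cast hn
  -- Since `b ≤ √η * τ`, this value is at most `1 / (2 * b)`; the factor `2` makes the inequality
  -- strict.
  have hhalf : 1 / (2 * (Real.sqrt η * τ)) < 1 / b :=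
    one_div_lt_one_div_of_lt hb (by nlinarith)
  unfold hybridRadius
  split_ifs with h
  · refine ⟨1 / (2 * (Real.sqrt η * τ)), by positivity, hhalf, ?_⟩
    have e1 : (1 / (2 * (Real.sqrt η * τ))) ^ 2 * τ ^ 2 / 2 * n = n / (8 * η) := by
      have e0 : (1 / (2 * (Real.sqrt η * τ))) ^ 2 = 1 / (4 * η * τ ^ 2) := by
        rw [div_pow, mul_pow, mul_pow, hs2]
        ring
      rw [e0]
      field_simp
      norm_num
    have e2 : 1 / (2 * (Real.sqrt η * τ)) * (n * (8 * Real.sqrt η * τt * L / n)) =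
        4 * L * (τt / τ) := by
      field_simp
      ring
    have e3 : n / (8 * η) ≤ L := by
      rw [div_le_iff₀ (by positivity)]
      linarith
    have e4 : 1 ≤ τt / τ := (one_le_div hτ).mpr hτt
    rw [e1, e2]
    nlinarith
  · push Not at h
    set s := Real.sqrt (8 * L / n) with hsdef
    have hs0 : 0 < s := Real.sqrt_pos.mpr (by positivity)
    have hsn : s ^ 2 * n = 8 * L := by
      rw [hsdef, Real.sq_sqrt (by positivity)]
      field_simp
    have hr : Real.sqrt (8 * τt ^ 2 * L / n) = s * τt := by
      rw [show 8 * τt ^ 2 * L / n = 8 * L / n * τt ^ 2 by ring, Real.sqrt_mul (by positivity),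
        Real.sqrt_sq (by linarith)]
    -- This is the threshold `n ≥ 8 * η * L` rewritten; it keeps `s / (2 * τ)` below the value in
    -- `hhalf`.
    have hsη : s * Real.sqrt η ≤ 1 := by
      refine (sq_le_sq₀ (by positivity) (by norm_num)).mp ?_
      rw [mul_pow, hs2]
      refine le_of_mul_le_mul_right (a := (n : ℝ)) ?_ hn'
      nlinarith
    refine ⟨s / (2 * τ), by positivity, lt_of_le_of_lt ?_ hhalf, ?_⟩
    · rw [div_le_div_iff₀ (by positivity) (by positivity)]
      nlinarith
    · rw [hr]
      have e1 : (s / (2 * τ)) ^ 2 * τ ^ 2 / 2 * n = s ^ 2 * n / 8 := by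
        field_simp
        norm_num
      have e2 : s / (2 * τ) * (n * (s * τt)) = s ^ 2 * n / 2 * (τt / τ) := by
        field_simp
      have e4 : 1 ≤ τt / τ := (one_le_div hτ).mpr hτt
      rw [e1, e2, hsn]
      nlinarith

/-! ### Optimism of the index -/

section UCBIndex

variable {M K : ℕ} {τt η : ℝ} {T : ℕ} {c : ℕ → Policy K} {u : ℕ → User M K}

lemma ucbIndex_of_pulls_ne_zero {π : Policy K} {t : ℕ} (h : pulls c π t ≠ 0) :
    ucbIndex τt η T c u π t =
      ((returnSum c u π t / pulls c π t +
        hybridRadius τt η (Real.log T) (pulls c π t) : ℝ) : EReal) := by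
  unfold ucbIndex hybridRadius
  rw [if_neg h]
  split_ifs <;> rfl

lemma le_ucbIndex {π : Policy K} {t : ℕ} {m : ℝ}
    (h : pulls c π t ≠ 0 → pulls c π t * m - returnSum c u π t ≤
      pulls c π t * hybridRadius τt η (Real.log T) (pulls c π t)) :
    (m : EReal) ≤ ucbIndex τt η T c u π t := by
  by_cases hn : pulls c π t = 0
  · simp [ucbIndex, hn]
  · rw [ucbIndex_of_pulls_ne_zero hn, EReal.coe_le_coe_iff]
    have hn' : (0 : ℝ) < pulls c π t := by exact_mod_cast Nat.pos_of_ne_zero hn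
    rw [div_add' _ _ _ hn'.ne', le_div_iff₀ hn']
    linarith [h hn]

/-- If the empirical means of the policies are within the confidence radius, then a policy that
maximizes the upper confidence bound is not much worse than any other one. -/
lemma sub_le_lossBound_of_concentration {D : ℝ} {S : Finset (Policy K)} {t : ℕ}
    (m : Policy K → ℝ) (hη : 0 < η) (hT : 0 < Real.log T) (hc : c t ∈ S)
    (hmax : ∀ π ∈ S, ucbIndex τt η T c u π t ≤ ucbIndex τt η T c u (c t) t)
    (hD : ∀ π ∈ S, ∀ π' ∈ S, m π - m π' ≤ D)
    (hdev : ∀ π ∈ S, pulls c π t ≠ 0 → |returnSum c u π t - pulls c π t * m π| ≤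
      pulls c π t * hybridRadius τt η (Real.log T) (pulls c π t))
    {π : Policy K} (hπ : π ∈ S) :
    m π - m (c t) ≤ lossBound τt η D (Real.log T) (pulls c (c t) t) := by
  -- Optimism: the index of `π` dominates its mean, and the chosen index dominates that of `π`.
  have hlow : (m π : EReal) ≤ ucbIndex τt η T c u (c t) t := by
    refine (le_ucbIndex fun hn => ?_).trans (hmax π hπ)
    linarith [(abs_le.mp (hdev π hπ hn)).1]
  by_cases hlt : (pulls c (c t) t : ℝ) < 8 * η * Real.log T
  · rw [lossBound, if_pos hlt]
    exact hD π hπ _ hc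
  · have hn' : (0 : ℝ) < pulls c (c t) t :=
      lt_of_lt_of_le (by positivity) (not_lt.mp hlt)
    have hn : pulls c (c t) t ≠ 0 := by
      rintro h
      simp [h] at hn'
    rw [ucbIndex_of_pulls_ne_zero hn, EReal.coe_le_coe_iff, div_add' _ _ _ hn'.ne',
      le_div_iff₀ hn'] at hlow
    -- One radius comes from the index and a second from the deviation of the chosen policy's own
    -- mean, whence the factor `2`.
    have hup := (abs_le.mp (hdev _ hc hn)).2
    simp only [hybridRadius, if_neg hlt] at hlow hup
    rw [lossBound, if_neg hlt]
    refine le_of_mul_le_mul_left ?_ hn'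
    linarith

end UCBIndex

/-! ### Exponential processes and independence of the current user -/

/-- The exponential process of the deviation of the returns of `π` from their mean. -/
noncomputable def expProcess {M K : ℕ} (env : DepartingBandit M K) (π : Policy K) (τsq γ : ℝ)
    (c : ℕ → Policy K) (u : ℕ → User M K) (t : ℕ) : ℝ :=
  Real.exp (γ * (returnSum c u π t - pulls c π t * π.expectedValue env) -
    γ ^ 2 * τsq / 2 * pulls c π t)

lemma expProcess_succ {M K : ℕ} (env : DepartingBandit M K) (π : Policy K) (τsq γ : ℝ)
    (c : ℕ → Policy K) (u : ℕ → User M K) (t : ℕ) :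
    expProcess env π τsq γ c u (t + 1) = expProcess env π τsq γ c u t *
      if c t = π then Real.exp (γ * (π.value (u t) - π.expectedValue env)) *
        Real.exp (-(γ ^ 2 * τsq / 2)) else 1 := by
  unfold expProcess
  rw [pulls_succ, returnSum_succ]
  split_ifs
  · rw [← Real.exp_add, ← Real.exp_add]
    congr 1
    push_cast
    ring
  · simp

/-- A deviation larger than `n * r` is witnessed by one of the two exponential processes. -/
lemma one_le_expProcess_of_deviation {M K : ℕ} {env : DepartingBandit M K} {π : Policy K}
    {τsq γ r L : ℝ} {c : ℕ → Policy K} {u : ℕ → User M K} {t : ℕ} (hγ : 0 ≤ γ)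
    (hr : γ ^ 2 * τsq / 2 * pulls c π t - γ * (pulls c π t * r) ≤ -L)
    (hdev : pulls c π t * r < |returnSum c u π t - pulls c π t * π.expectedValue env|) :
    1 ≤ Real.exp (-L) *
      (expProcess env π τsq γ c u t + expProcess env π τsq (-γ) c u t) := by
  unfold expProcess
  rw [mul_add, ← Real.exp_add, ← Real.exp_add]
  rcases lt_abs.mp hdev with h | h
  · refine le_add_of_le_of_nonneg (Real.one_le_exp ?_) (Real.exp_pos _).le
    nlinarith [mul_le_mul_of_nonneg_left h.le hγ]
  · refine le_add_of_nonneg_of_le (Real.exp_pos _).le (Real.one_le_exp ?_)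
    nlinarith [mul_le_mul_of_nonneg_left h.le hγ]

namespace IsUCBHybridRun

variable {Ω : Type*} {mΩ : MeasurableSpace Ω} {μ : Measure Ω}
  {M K : ℕ} {env : DepartingBandit M K} {S : Finset (Policy K)} {τt η : ℝ} {T : ℕ}
  {ℱ : Filtration ℕ mΩ} {U : ℕ → Ω → User M K} {c : ℕ → Ω → Policy K}

/-- The user of a round is independent of everything that is known before the round. -/
lemma integrable_and_integral_user_mul (h : IsUCBHybridRun μ env S τt η T ℱ U c) {t : ℕ}
    (ht : t < T) {f : User M K → ℝ} (hf : Measurable f) (hfi : Integrable f env.userLaw)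
    {Y : Ω → ℝ} (hY : Measurable[ℱ t] Y) (hYi : Integrable Y μ) :
    Integrable (fun ω => f (U t ω) * Y ω) μ ∧
      ∫ ω, f (U t ω) * Y ω ∂μ = (∫ u, f u ∂env.userLaw) * ∫ ω, Y ω ∂μ := by
  have hlaw := h.user_law t ht
  have hU : Measurable (U t) := (h.user_measurable t ht).mono (ℱ.le _) le_rfl
  have hi : Integrable (fun ω => f (U t ω)) μ := by
    rw [← hlaw.map_eq] at hfi
    exact hfi.comp_measurable hU
  have hind : IndepFun (fun ω => f (U t ω)) Y μ := by
    have h0 : IndepFun (U t) Y μ :=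
      (IndepFun_iff_Indep _ _ _).mpr (indep_of_indep_of_le_right (h.user_indep t ht) hY.comap_le)
    exact h0.comp hf measurable_id
  refine ⟨hind.integrable_mul hi hYi, ?_⟩
  have he := hind.integral_mul_eq_mul_integral hi.aestronglyMeasurable hYi.aestronglyMeasurable
  have hl : ∫ ω, f (U t ω) ∂μ = ∫ u, f u ∂env.userLaw := by
    rw [← hlaw.map_eq, integral_map hU.aemeasurable hf.aestronglyMeasurable]
  rw [← hl]
  exact he

/-- In a round that uses `π`, the process gains a factor that is independent of the past and has
mean at most `1` by sub-exponentiality; in other rounds it is unchanged. Measurability with respect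
to `ℱ t` is carried along because the independence argument needs it. -/
lemma expProcess_supermartingale [IsProbabilityMeasure μ]
    (h : IsUCBHybridRun μ env S τt η T ℱ U c) {π : Policy K}
    {τsq b γ : ℝ} (hπ : IsSubExponential (fun u : User M K => π.value u) τsq b env.userLaw)
    (hγ : |γ| < 1 / b) (t : ℕ) (ht : t ≤ T) :
    Measurable[ℱ t] (fun ω => expProcess env π τsq γ (fun s => c s ω) (fun s => U s ω) t) ∧
    Integrable (fun ω => expProcess env π τsq γ (fun s => c s ω) (fun s => U s ω) t) μ ∧
    ∫ ω, expProcess env π τsq γ (fun s => c s ω) (fun s => U s ω) t ∂μ ≤ 1 := by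
  induction t with
  | zero =>
    have : ∀ ω, expProcess env π τsq γ (fun s => c s ω) (fun s => U s ω) 0 = 1 := by
      intro ω
      simp [expProcess, pulls, returnSum]
    simp only [this]
    exact ⟨measurable_const, integrable_const _, by simp⟩
  | succ t ih =>
    obtain ⟨hm, hi, hle⟩ := ih (by omega)
    have ht' : t < T := by omega
    obtain ⟨hexp, hexp_le⟩ := hπ.2 γ hγ
    set X : Ω → ℝ := fun ω => expProcess env π τsq γ (fun s => c s ω) (fun s => U s ω) t with hX
    have hXpos : ∀ ω, 0 ≤ X ω := fun ω => (Real.exp_pos _).le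
    set A : Set Ω := {ω | c t ω = π} with hA
    have hAm : MeasurableSet[ℱ t] A := h.choice_measurable t ht' π
    have hAm' : MeasurableSet A := ℱ.le t _ hAm
    set f : User M K → ℝ := fun u =>
      Real.exp (γ * (π.value u - π.expectedValue env)) * Real.exp (-(γ ^ 2 * τsq / 2)) with hf
    have hfm : Measurable f := by
      have := Policy.measurable_value (M := M) π
      fun_prop
    have hfi : Integrable f env.userLaw := hexp.mul_const _
    have hfle : ∫ u, f u ∂env.userLaw ≤ 1 := by
      rw [hf, integral_mul_const]
      calc _ ≤ Real.exp (γ ^ 2 * τsq / 2) * Real.exp (-(γ ^ 2 * τsq / 2)) := by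
            gcongr
            exact hexp_le
        _ = 1 := by rw [← Real.exp_add]; simp
    have hsucc : (fun ω => expProcess env π τsq γ (fun s => c s ω) (fun s => U s ω) (t + 1)) =
        fun ω => f (U t ω) * A.indicator X ω + Aᶜ.indicator X ω := by
      funext ω
      rw [expProcess_succ]
      by_cases hω : c t ω = π
      · have h1 : ω ∈ A := hω
        simp [hω, h1, hf, hX, mul_comm]
      · have h1 : ω ∉ A := hω
        simp [hω, h1, hX]
    obtain ⟨hi1, he1⟩ := h.integrable_and_integral_user_mul ht' hfm hfi
      (hm.indicator hAm) (hi.indicator hAm')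
    have hi2 : Integrable (Aᶜ.indicator X) μ := hi.indicator hAm'.compl
    rw [hsucc]
    refine ⟨?_, hi1.add hi2, ?_⟩
    · have hmono : ℱ t ≤ ℱ (t + 1) := ℱ.mono (Nat.le_succ t)
      have hfU : Measurable[ℱ (t + 1)] fun ω => f (U t ω) :=
        hfm.comp (h.user_measurable t ht')
      exact (hfU.mul ((hm.indicator hAm).mono hmono le_rfl)).add
        ((hm.indicator hAm.compl).mono hmono le_rfl)
    · rw [integral_add hi1 hi2, he1]
      have hs : ∫ ω, A.indicator X ω ∂μ + ∫ ω, Aᶜ.indicator X ω ∂μ = ∫ ω, X ω ∂μ := by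
        rw [integral_indicator hAm', integral_indicator hAm'.compl,
          integral_add_compl hAm' hi]
      have h0 : 0 ≤ ∫ ω, A.indicator X ω ∂μ :=
        integral_nonneg fun ω => Set.indicator_nonneg (fun ω _ => hXpos ω) ω
      nlinarith

/-- The return of a round has the conditional mean of the chosen policy. -/
lemma integrable_and_integral_value [IsProbabilityMeasure μ]
    (h : IsUCBHybridRun μ env S τt η T ℱ U c)
    (hint : ∀ π ∈ S, Integrable (fun u : User M K => π.value u) env.userLaw) {t : ℕ}
    (ht : t < T) :
    Integrable (fun ω => (c t ω).value (U t ω)) μ ∧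
      Integrable (fun ω => (c t ω).expectedValue env) μ ∧
      ∫ ω, (c t ω).value (U t ω) ∂μ = ∫ ω, (c t ω).expectedValue env ∂μ := by
  -- The random policy is split into its finitely many values; each indicator is known before the
  -- user arrives and hence independent of her.
  set Y : Policy K → Ω → ℝ := fun π => {ω | c t ω = π}.indicator fun _ => 1 with hY
  have hYm : ∀ π, Measurable[ℱ t] (Y π) := fun π =>
    (@measurable_const ℝ Ω _ (ℱ t) 1).indicator (h.choice_measurable t ht π)
  have hYi : ∀ π, Integrable (Y π) μ := fun π =>
    (integrable_const (1 : ℝ)).indicator (ℱ.le t _ (h.choice_measurable t ht π))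
  have hsum : ∀ (g : Policy K → ℝ) (ω : Ω), g (c t ω) = ∑ π ∈ S, g π * Y π ω := by
    intro g ω
    simp [hY, Set.indicator_apply, h.choice_mem t ht ω]
  have h1 : (fun ω => (c t ω).value (U t ω)) =
      fun ω => ∑ π ∈ S, π.value (U t ω) * Y π ω :=
    funext fun ω => hsum (fun π => π.value (U t ω)) ω
  have h2 : (fun ω => (c t ω).expectedValue env) =
      fun ω => ∑ π ∈ S, π.expectedValue env * Y π ω :=
    funext fun ω => hsum (fun π => π.expectedValue env) ω
  have key := fun π hπ => h.integrable_and_integral_user_mul ht (Policy.measurable_value π)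
    (hint π hπ) (hYm π) (hYi π)
  rw [h1, h2]
  refine ⟨integrable_finsetSum _ fun π hπ => (key π hπ).1,
    integrable_finsetSum _ fun π _ => (hYi π).const_mul _, ?_⟩
  rw [integral_finsetSum _ fun π hπ => (key π hπ).1,
    integral_finsetSum _ fun π _ => (hYi π).const_mul _]
  refine Finset.sum_congr rfl fun π hπ => ?_
  rw [(key π hπ).2, integral_const_mul]
  rfl

end IsUCBHybridRun

/-! ### The expected loss of one round -/

namespace IsUCBHybridRun

variable {Ω : Type*} {mΩ : MeasurableSpace Ω} {μ : Measure Ω} [IsProbabilityMeasure μ]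
  {M K : ℕ} {env : DepartingBandit M K} {S : Finset (Policy K)} {τt η : ℝ} {T : ℕ}
  {ℱ : Filtration ℕ mΩ} {U : ℕ → Ω → User M K} {c : ℕ → Ω → Policy K}

/-- The loss of a round is at most the loss bound, up to an error of small expectation. -/
lemma exists_sub_le_lossBound_add (h : IsUCBHybridRun μ env S τt η T ℱ U c) {D : ℝ}
    (hS : S.Nonempty) (hT : 2 ≤ T) (hpar : AssociatedParameters env S τt η)
    (hD : ∀ π ∈ S, ∀ π' ∈ S, π.expectedValue env - π'.expectedValue env ≤ D)
    {t : ℕ} (ht : t < T) :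
    ∃ E : Ω → ℝ, Integrable E μ ∧ ∫ ω, E ω ∂μ ≤ 2 * S.card / T ^ 2 ∧ ∀ ω, ∀ π ∈ S,
      π.expectedValue env - (c t ω).expectedValue env ≤
        lossBound τt η D (Real.log T)
          (pulls (fun s => c s ω) (c t ω) t) + D * E ω := by
  have hT1 : (1 : ℝ) < T := by exact_mod_cast hT
  have hL : 0 < Real.log T := Real.log_pos hT1
  set L := Real.log T with hLdef
  have hη : 0 < η := by
    obtain ⟨π, hπ⟩ := hS
    obtain ⟨τ, b, hτ, hb, -, -, h2⟩ := hpar π hπ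
    exact lt_of_lt_of_le (by positivity) h2
  have hD0 : 0 ≤ D := by
    obtain ⟨π, hπ⟩ := hS
    simpa using hD π hπ π hπ
  -- The exponent may depend on the candidate count `n` but not on `ω`. Outside `S`, or for `n = 0`,
  -- the choice carries no deviation estimate.
  have hex : ∀ (π : Policy K) (n : ℕ), ∃ τ b γ : ℝ, π ∈ S →
      IsSubExponential (fun u : User M K => π.value u) (τ ^ 2) b env.userLaw ∧
      0 ≤ γ ∧ γ < 1 / b ∧ (n ≠ 0 →
        γ ^ 2 * τ ^ 2 / 2 * n - γ * (n * hybridRadius τt η L n) ≤ -(3 * L)) := by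
    intro π n
    by_cases hπ : π ∈ S
    · obtain ⟨τ, b, hτ, hb, hsub, h1, h2⟩ := hpar π hπ
      rcases Nat.eq_zero_or_pos n with rfl | hn
      · exact ⟨τ, b, 0, fun _ => ⟨hsub, le_rfl, by positivity, fun h0 => absurd rfl h0⟩⟩
      · obtain ⟨γ, hγ0, hγb, hγ⟩ := exists_exponent hL hτ hb h1 h2 hn
        exact ⟨τ, b, γ, fun _ => ⟨hsub, hγ0, hγb, fun _ => hγ⟩⟩
    · exact ⟨0, 0, 0, fun h0 => absurd h0 hπ⟩
  choose τ b γ hγ using hex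
  set W : Policy K → ℕ → Ω → ℝ := fun π n ω => Real.exp (-(3 * L)) *
    (expProcess env π (τ π n ^ 2) (γ π n) (fun s => c s ω) (fun s => U s ω) t +
      expProcess env π (τ π n ^ 2) (-γ π n) (fun s => c s ω) (fun s => U s ω) t) with hW
  have hW0 : ∀ π n ω, 0 ≤ W π n ω := fun π n ω =>
    mul_nonneg (Real.exp_pos _).le (add_nonneg (Real.exp_pos _).le (Real.exp_pos _).le)
  have hWint : ∀ π ∈ S, ∀ n, Integrable (W π n) μ ∧
      ∫ ω, W π n ω ∂μ ≤ Real.exp (-(3 * L)) * 2 := by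
    intro π hπ n
    obtain ⟨hsub, h0, hb, -⟩ := hγ π n hπ
    obtain ⟨-, hi1, hl1⟩ := h.expProcess_supermartingale hsub
      (γ := γ π n) (by rwa [abs_of_nonneg h0]) t ht.le
    obtain ⟨-, hi2, hl2⟩ := h.expProcess_supermartingale hsub
      (γ := -γ π n) (by rwa [abs_neg, abs_of_nonneg h0]) t ht.le
    refine ⟨(hi1.add hi2).const_mul _, ?_⟩
    rw [hW, integral_const_mul, integral_add hi1 hi2]
    gcongr
    linarith
  have hexp : Real.exp (-(3 * L)) = ((T : ℝ) ^ 3)⁻¹ := by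
    rw [Real.exp_neg, hLdef, ← Real.rpow_natCast, Real.rpow_def_of_pos (by linarith)]
    congr 2
    push_cast
    ring
  -- Markov's inequality and the union bound in one: the error is a sum of nonnegative weights, and
  -- it is at least `1` as soon as one mean leaves its radius. The `T` counts use up one factor of
  -- `T ^ 3`.
  refine ⟨fun ω => ∑ π ∈ S, ∑ n ∈ Finset.range T, W π n ω,
    integrable_finsetSum _ fun π hπ => integrable_finsetSum _ fun n _ => (hWint π hπ n).1,
    ?_, ?_⟩
  · rw [integral_finsetSum _ fun π hπ => integrable_finsetSum _ fun n _ => (hWint π hπ n).1]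
    have h1 : ∀ π ∈ S, ∫ ω, ∑ n ∈ Finset.range T, W π n ω ∂μ ≤
        T * (Real.exp (-(3 * L)) * 2) := by
      intro π hπ
      rw [integral_finsetSum _ fun n _ => (hWint π hπ n).1]
      simpa using Finset.sum_le_card_nsmul (Finset.range T) _ _ fun n _ => (hWint π hπ n).2
    refine (Finset.sum_le_card_nsmul S _ _ h1).trans (le_of_eq ?_)
    rw [nsmul_eq_mul, hexp]
    field_simp
  · intro ω π hπ
    have hnonneg : 0 ≤ ∑ π ∈ S, ∑ n ∈ Finset.range T, W π n ω :=
      Finset.sum_nonneg fun π _ => Finset.sum_nonneg fun n _ => hW0 π n ω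
    have hct := h.choice_mem t ht ω
    by_cases hdev : ∀ π ∈ S, pulls (fun s => c s ω) π t ≠ 0 →
        |returnSum (fun s => c s ω) (fun s => U s ω) π t -
          pulls (fun s => c s ω) π t * π.expectedValue env| ≤
        pulls (fun s => c s ω) π t * hybridRadius τt η L (pulls (fun s => c s ω) π t)
    · have := sub_le_lossBound_of_concentration (fun π => π.expectedValue env) hη hL
        hct (h.choice_max t ht ω) hD hdev hπ
      have hDE := mul_nonneg hD0 hnonneg
      exact this.trans (le_add_of_nonneg_right hDE)
    · push Not at hdev
      obtain ⟨ρ, hρ, hne, hlt⟩ := hdev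
      set n := pulls (fun s => c s ω) ρ t with hn
      obtain ⟨-, h0, -, hexpo⟩ := hγ ρ n hρ
      have h1 : 1 ≤ W ρ n ω := one_le_expProcess_of_deviation h0 (hexpo hne) hlt
      -- The actual random count is one of the candidates because fewer than `T` users have come
      -- before.
      have h2 : 1 ≤ ∑ π ∈ S, ∑ n ∈ Finset.range T, W π n ω := by
        have hnT : n ∈ Finset.range T :=
          Finset.mem_range.mpr ((pulls_le _ _ _).trans_lt ht)
        calc 1 ≤ W ρ n ω := h1
          _ ≤ ∑ n ∈ Finset.range T, W ρ n ω :=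
            Finset.single_le_sum (f := fun n => W ρ n ω) (fun n _ => hW0 ρ n ω) hnT
          _ ≤ _ := Finset.single_le_sum (f := fun π => ∑ n ∈ Finset.range T, W π n ω)
            (fun π _ => Finset.sum_nonneg fun n _ => hW0 π n ω) hρ
      have h3 : 0 ≤ lossBound τt η D L (pulls (fun s => c s ω) (c t ω) t) := by
        unfold lossBound
        split_ifs <;> positivity
      have h4 := hD π hπ _ hct
      have h5 := mul_le_mul_of_nonneg_left h2 hD0
      linarith

end IsUCBHybridRun

/-! ### Summation over the rounds -/

theorem mainTheorem7 (τt η D : ℝ) :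
    ∃ C : ℝ, ∀ (M K : ℕ) (env : DepartingBandit M K) (S : Finset (Policy K)) (hS : S.Nonempty),
      AssociatedParameters env S τt η →
      (∀ π ∈ S, ∀ π' ∈ S, π.expectedValue env - π'.expectedValue env ≤ D) →
      ∀ T : ℕ, 2 ≤ T →
      ∀ (Ω : Type*) (mΩ : MeasurableSpace Ω) (μ : Measure Ω) (_ : IsProbabilityMeasure μ)
        (ℱ : Filtration ℕ mΩ) (U : ℕ → Ω → User M K) (c : ℕ → Ω → Policy K),
        IsUCBHybridRun μ env S τt η T ℱ U c →
        Integrable (regret env S hS T U c) μ ∧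
        ∫ ω, regret env S hS T U c ω ∂μ
          ≤ C * (Real.sqrt (S.card * T * Real.log T) + S.card * Real.log T) := by
  -- `8 * η * D` and `4 * √8 * τt` come from the summed loss bound. `6 * D` absorbs the remaining `D
  -- + 2 * D` per policy, as `log T ≥ log 2 ≥ 1 / 2`.
  refine ⟨8 * η * D + 6 * D + 4 * Real.sqrt 8 * τt, ?_⟩
  intro M K env S hS hpar hD T hT Ω mΩ μ _ ℱ U c h
  have hint : ∀ π ∈ S, Integrable (fun u : User M K => π.value u) env.userLaw := by
    intro π hπ
    obtain ⟨τ, b, -, -, hsub, -⟩ := hpar π hπ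
    exact hsub.1
  obtain ⟨hτ, hη, hD0⟩ : 0 ≤ τt ∧ 0 ≤ η ∧ 0 ≤ D := by
    obtain ⟨π, hπ⟩ := hS
    obtain ⟨τ, b, hτ, hb, -, h1, h2⟩ := hpar π hπ
    exact ⟨hτ.le.trans h1, le_trans (by positivity) h2, by simpa using hD π hπ π hπ⟩
  have hT2 : (2 : ℝ) ≤ T := by exact_mod_cast hT
  have hL : 1 / 2 ≤ Real.log T := by
    have := Real.log_le_log (by norm_num) hT2
    linarith [Real.log_two_gt_d9]
  have key := fun t ht => h.integrable_and_integral_value hint (t := t) ht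
  obtain ⟨ρ, hρ, hsup⟩ := S.exists_mem_eq_sup' hS fun π => (T : ℝ) * π.expectedValue env
  have hvi : Integrable (fun ω => ∑ t ∈ Finset.range T, (c t ω).value (U t ω)) μ :=
    integrable_finsetSum _ fun t ht => (key t (Finset.mem_range.mp ht)).1
  have hreg : regret env S hS T U c = fun ω =>
      T * ρ.expectedValue env - ∑ t ∈ Finset.range T, (c t ω).value (U t ω) := by
    funext ω
    rw [regret, hsup]
  rw [hreg]
  refine ⟨(integrable_const _).sub hvi, ?_⟩
  have hli : ∀ t ∈ Finset.range T, Integrable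
      (fun ω => ρ.expectedValue env - (c t ω).expectedValue env) μ := fun t ht =>
    (integrable_const _).sub (key t (Finset.mem_range.mp ht)).2.1
  -- In expectation each return may be replaced by the mean of the policy chosen in that round.
  have heq : ∫ ω, (T * ρ.expectedValue env - ∑ t ∈ Finset.range T, (c t ω).value (U t ω)) ∂μ =
      ∫ ω, ∑ t ∈ Finset.range T, (ρ.expectedValue env - (c t ω).expectedValue env) ∂μ := by
    rw [integral_sub (integrable_const _) hvi, integral_finsetSum _ hli,
      integral_finsetSum _ fun t ht => (key t (Finset.mem_range.mp ht)).1]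
    have hterm : ∀ t ∈ Finset.range T,
        ∫ ω, (ρ.expectedValue env - (c t ω).expectedValue env) ∂μ =
          ρ.expectedValue env - ∫ ω, (c t ω).value (U t ω) ∂μ := by
      intro t ht
      rw [integral_sub (integrable_const _) (key t (Finset.mem_range.mp ht)).2.1,
        (key t (Finset.mem_range.mp ht)).2.2]
      simp
    rw [Finset.sum_congr rfl hterm]
    simp
  rw [heq]
  have hex : ∀ t, ∃ E : Ω → ℝ, t < T → Integrable E μ ∧ ∫ ω, E ω ∂μ ≤ 2 * S.card / T ^ 2 ∧
      ∀ ω, ∀ π ∈ S, π.expectedValue env - (c t ω).expectedValue env ≤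
        lossBound τt η D (Real.log T) (pulls (fun s => c s ω) (c t ω) t) + D * E ω := by
    intro t
    by_cases ht : t < T
    · obtain ⟨E, hE⟩ := h.exists_sub_le_lossBound_add hS hT hpar hD ht
      exact ⟨E, fun _ => hE⟩
    · exact ⟨0, fun h0 => absurd h0 ht⟩
  choose E hE using hex
  set B : ℝ := S.card * (D * (8 * η * Real.log T + 1)) +
    4 * Real.sqrt 8 * τt * Real.sqrt (S.card * T * Real.log T) with hB
  have hEi : Integrable (fun ω => ∑ t ∈ Finset.range T, E t ω) μ :=
    integrable_finsetSum _ fun t ht => (hE t (Finset.mem_range.mp ht)).1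
  have hpoint : ∀ ω, ∑ t ∈ Finset.range T, (ρ.expectedValue env - (c t ω).expectedValue env) ≤
      B + D * ∑ t ∈ Finset.range T, E t ω := by
    intro ω
    have h1 := sum_lossBound_pulls_le hτ hη hD0 (L := Real.log T) (by linarith) S
      (fun s => c s ω) T fun t ht => h.choice_mem t ht ω
    refine (Finset.sum_le_sum fun t ht =>
      (hE t (Finset.mem_range.mp ht)).2.2 ω ρ hρ).trans ?_
    rw [Finset.sum_add_distrib, ← Finset.mul_sum]
    exact add_le_add_left h1 _
  -- The sum is in fact at most `2 * S.card / T`; a bound free of `T` suffices.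
  have hEle : ∫ ω, ∑ t ∈ Finset.range T, E t ω ∂μ ≤ 2 * S.card := by
    rw [integral_finsetSum _ fun t ht => (hE t (Finset.mem_range.mp ht)).1]
    have h1 := Finset.sum_le_card_nsmul (Finset.range T) (fun t => ∫ ω, E t ω ∂μ) _
      fun t ht => (hE t (Finset.mem_range.mp ht)).2.1
    refine h1.trans ?_
    rw [Finset.card_range, nsmul_eq_mul, ← mul_div_assoc, div_le_iff₀ (by positivity)]
    have : (T : ℝ) ≤ T ^ 2 := by nlinarith
    nlinarith [mul_le_mul_of_nonneg_left this (by positivity : (0 : ℝ) ≤ 2 * S.card)]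
  have hbound : ∫ ω, ∑ t ∈ Finset.range T,
      (ρ.expectedValue env - (c t ω).expectedValue env) ∂μ ≤ B + D * (2 * S.card) := by
    refine (integral_mono (integrable_finsetSum _ hli)
      ((integrable_const B).add (hEi.const_mul D)) hpoint).trans ?_
    simp only [Pi.add_apply]
    rw [integral_add (integrable_const B) (hEi.const_mul D), integral_const_mul]
    simp only [integral_const, probReal_univ, one_smul]
    gcongr
  refine hbound.trans ?_
  set R := Real.sqrt (S.card * T * Real.log T)
  have hR : 0 ≤ R := Real.sqrt_nonneg _
  have hn : (0 : ℝ) ≤ S.card := by positivity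
  have h1 : 0 ≤ (8 * η * D + 6 * D) * R := by positivity
  have h2 : 0 ≤ 4 * Real.sqrt 8 * τt * (S.card * Real.log T) := by
    have : 0 ≤ Real.log T := by linarith
    positivity
  have h3 : 3 * D * S.card ≤ 6 * D * (S.card * Real.log T) := by
    nlinarith [mul_le_mul_of_nonneg_left hL (mul_nonneg hD0 hn)]
  rw [hB]
  linarith
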